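/- Let $d\ge 2$, let $S$ be the uniform probability measure on the unit sphere $\mathbb S^{d-1}\subset\mathbb R^d$, and let $C^\infty_{even}(\mathbb S^{d-1})$ be the space of smooth real-valued functions $\varphi$ on $\mathbb S^{d-1}$ with $\varphi(-x)=\varphi(x)$. Write $\langle g,f\rangle=\int_{\mathbb S^{d-1}} g f\,dS$ and let $T\varphi(x)=\int_{\mathbb S^{d-1}}|x^Ty|\,\varphi(y)\,dS(y)$ (the Blaschke–Levy operator). For a signed Radon measure $\pi$ on $\mathbb S^{d-1}$ let $\|\pi\|_1$ be its total variation and $h_\pi(x)=\int_{\mathbb S^{d-1}}|w^Tx|\,d\pi(w)$; call $\pi$ even if $\pi(-A)=\pi(A)$ for all Borel sets $A$. Let $$\mathcal H^1=\{h_\pi : \pi \text{ an even signed Radon measure}\},\qquad \gamma_1(f)=\inf\{\|\pi\|_1 : \pi \text{ an even signed Radon measure},\ h_\pi=f\}\quad (f\in\mathcal H^1).$$ Then $T$ maps $C^\infty_{even}(\mathbb S^{d-1})$ bijectively onto itself, so that $T^{-1}$ is defined on $C^\infty_{even}(\mathbb S^{d-1})$, and for every even continuous function $f:\mathbb S^{d-1}\to\mathbb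 R$ it holds that $f\in\mathcal H^1$ if and only if $$\sup_{\varphi\in C^\infty_{even}(\mathbb S^{d-1}),\ \|\varphi\|_\infty\le 1}\langle T^{-1}\varphi,f\rangle<\infty .$$ In this case $$\gamma_1(f)=\sup_{\varphi\in C^\infty_{even}(\mathbb S^{d-1}),\ \|\varphi\|_\infty\le 1}\langle T^{-1}\varphi,f\rangle .$$ -/

import Mathlib

open MeasureTheory Set
open scoped Manifold ContDiff

noncomputable section

namespace CosineTransform

/-- The unit sphere `𝕊ⁿ = 𝕊^{d-1}` of `ℝ^d` with the Euclidean norm, where `d = n + 1`. -/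
abbrev Sph (n : ℕ) : Type := Metric.sphere (0 : EuclideanSpace ℝ (Fin (n + 1))) 1

/-- The uniform probability measure on the sphere: normalized surface measure. -/
def unif (n : ℕ) : Measure (Sph n) :=
  ((volume : Measure (EuclideanSpace ℝ (Fin (n + 1)))).toSphere univ)⁻¹ •
    (volume : Measure (EuclideanSpace ℝ (Fin (n + 1)))).toSphere

/-- The kernel `|xᵀ y|`. -/
def absInner {n : ℕ} (x y : Sph n) : ℝ :=
  |inner ℝ (x : EuclideanSpace ℝ (Fin (n + 1))) (y : EuclideanSpace ℝ (Fin (n + 1)))|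

/-- The pairing `⟨g, f⟩ = ∫ g f dS` with respect to the uniform measure. -/
def pairing {n : ℕ} (g f : Sph n → ℝ) : ℝ := ∫ x, g x * f x ∂(unif n)

/-- A function on the sphere is even if `f (-x) = f x`. -/
def IsEvenFun {n : ℕ} (f : Sph n → ℝ) : Prop := ∀ x, f (-x) = f x

/-- The space `C^∞_even` of even smooth real functions on the sphere (a smooth manifold). -/
def smoothEven (n : ℕ) : Set (Sph n → ℝ) :=
  {φ | ContMDiff (𝓡 n) 𝓘(ℝ, ℝ) ∞ φ ∧ IsEvenFun φ}

/-- The Blaschke–Levy operator `(T φ)(x) = ∫ |xᵀ y| φ(y) dS(y)`. -/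
def T {n : ℕ} (φ : Sph n → ℝ) : Sph n → ℝ := fun x => ∫ y, absInner x y * φ y ∂(unif n)

/-- The inverse of `T` as a map on `C^∞_even`: `Tinv φ` is the `ψ ∈ C^∞_even` with `T ψ = φ`. -/
def Tinv {n : ℕ} (φ : Sph n → ℝ) : Sph n → ℝ := Function.invFunOn T (smoothEven n) φ

/-- A signed measure on the sphere is even if `π(-A) = π(A)` for all Borel sets `A`. Since the
sphere is a compact metric space, signed Radon measures are the finite signed Borel measures. -/
def IsEvenMeasure {n : ℕ} (π : SignedMeasure (Sph n)) : Prop :=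
  ∀ A : Set (Sph n), MeasurableSet A → π ((fun x => -x) ⁻¹' A) = π A

/-- The function `h_π(x) = ∫ |wᵀ x| dπ(w)`. -/
def h {n : ℕ} (π : SignedMeasure (Sph n)) : Sph n → ℝ := fun x => ∫ᵛ w, absInner w x ∂<•π

/-- The space `𝓗¹` of all `h_π` with `π` an even signed Radon measure. -/
def H1 (n : ℕ) : Set (Sph n → ℝ) :=
  {f | ∃ π : SignedMeasure (Sph n), IsEvenMeasure π ∧ f = h π}

/-- The variation norm `γ₁(f)`: the infimum of the total variations `‖π‖₁` of the even signed
measures `π` with `f = h_π` (it is used only for `f ∈ 𝓗¹`). -/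
def gamma1 {n : ℕ} (f : Sph n → ℝ) : ℝ :=
  sInf {r | ∃ π : SignedMeasure (Sph n),
    IsEvenMeasure π ∧ f = h π ∧ r = (π.totalVariation univ).toReal}

/-- The set of values `⟨T⁻¹ φ, f⟩` over all `φ ∈ C^∞_even` with `‖φ‖_∞ ≤ 1`. -/
def dualValues {n : ℕ} (f : Sph n → ℝ) : Set ℝ :=
  {r | ∃ φ ∈ smoothEven n, (∀ x, |φ x| ≤ 1) ∧ r = pairing (Tinv φ) f}

end CosineTransform

end

/-! The analytic core is the integral `∫₀^∞ r⁻² (1 - cos (a r)) dr = |a| cosConst`. Inserting it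
into `∫ |⟨x, ξ⟩| Φ(ξ) dξ` for an even Schwartz function `Φ` and exchanging integrals gives, up to a
positive constant, `∫₀^∞ r⁻² (𝓕 Φ 0 - 𝓕 Φ (r x)) dr`; in polar coordinates the left side is `T` of a
radial moment of `Φ` (`T_radialMoment`). Any smooth even `φ` extends to a smooth even function
supported in an annulus. With this extension as `Φ`, the moment is a multiple of `φ` and the right
side is smooth in `x ≠ 0`, so `T φ` is smooth. With the Fourier transform of the extension as `Φ`,
the right side is a multiple of `φ`, so `T` is onto. Symmetry of the kernel turns surjectivity into
injectivity.

The duality rests on `⟨T⁻¹ φ, h_π⟩ = ∫ φ dπ`, which bounds the supremum by `‖π‖₁`. Conversely, an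
upper bound `C` makes `φ ↦ ⟨T⁻¹ φ, f⟩` a functional of norm at most `C` for the sup norm.
Hahn–Banach and Riesz represent it by a signed measure of mass at most `C`, whose even part `π`
satisfies `h_π = f` because smooth even test functions separate continuous even functions
(`exists_evenMeasure_of_dualValues_le`). -/

noncomputable section

namespace CosineTransform

/-! ### Smoothness of radial integrals away from the origin -/

section RadialIntegral

variable {E F : Type} [NormedAddCommGroup E] [NormedSpace ℝ E]
  [NormedAddCommGroup F] [NormedSpace ℝ F]

/-- The function `w t • K (t • x)` is `O((1 + t²)⁻¹)`, uniformly for `x` in annuli. -/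
def RadialDecay (w : ℝ → ℝ) (K : E → F) : Prop :=
  ∀ δ R : ℝ, 0 < δ → ∃ C, ∀ t, 0 < t → ∀ x, δ ≤ ‖x‖ → ‖x‖ ≤ R →
    ‖w t • K (t • x)‖ ≤ C * (1 + t ^ 2)⁻¹

theorem le_mul_inv_one_add_sq {A C₁ C₂ t : ℝ} (h₁ : A ≤ C₁) (h₂ : t ^ 2 * A ≤ C₂) :
    A ≤ (C₁ + C₂) * (1 + t ^ 2)⁻¹ := by
  rw [← div_eq_mul_inv, le_div_iff₀ (by positivity)]
  linarith

theorem RadialDecay.of_bounds {w : ℝ → ℝ} {K : E → F}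
    (h : ∀ δ R : ℝ, 0 < δ → ∃ C₁ C₂, ∀ t, 0 < t → ∀ x, δ ≤ ‖x‖ → ‖x‖ ≤ R →
      ‖w t • K (t • x)‖ ≤ C₁ ∧ t ^ 2 * ‖w t • K (t • x)‖ ≤ C₂) : RadialDecay w K := by
  intro δ R hδ
  obtain ⟨C₁, C₂, hC⟩ := h δ R hδ
  exact ⟨C₁ + C₂, fun t ht x h1 h2 =>
    le_mul_inv_one_add_sq (hC t ht x h1 h2).1 (hC t ht x h1 h2).2⟩

theorem aestronglyMeasurable_radial {w : ℝ → ℝ} {K : E → F} (hw : ContinuousOn w (Ioi 0))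
    (hK : Continuous K) (x : E) :
    AEStronglyMeasurable (fun t => w t • K (t • x)) (volume.restrict (Ioi 0)) := by
  refine ContinuousOn.aestronglyMeasurable ?_ measurableSet_Ioi
  exact hw.smul (by fun_prop)

theorem RadialDecay.integrableOn {w : ℝ → ℝ} {K : E → F} (h : RadialDecay w K)
    (hw : ContinuousOn w (Ioi 0)) (hK : Continuous K) {x : E} (hx : x ≠ 0) :
    IntegrableOn (fun t => w t • K (t • x)) (Ioi 0) := by
  obtain ⟨C, hC⟩ := h ‖x‖ ‖x‖ (norm_pos_iff.2 hx)
  refine Integrable.mono' (integrable_inv_one_add_sq.const_mul C).integrableOn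
    (aestronglyMeasurable_radial hw hK x) ?_
  filter_upwards [ae_restrict_mem measurableSet_Ioi] with t ht
  exact hC t ht x le_rfl le_rfl

/-- Differentiation under the integral sign of `x ↦ ∫₀^∞ w(t) K(t x) dt` away from the origin. -/
theorem hasFDerivAt_radial_integral {w : ℝ → ℝ} {K : E → F} {K' : E → E →L[ℝ] F}
    (hw : ContinuousOn w (Ioi 0)) (hK : ∀ x, HasFDerivAt K (K' x) x) (hK' : Continuous K')
    (h₀ : RadialDecay w K) (h₁ : RadialDecay (fun t => w t * t) K') {x₀ : E} (hx₀ : x₀ ≠ 0) :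
    HasFDerivAt (fun x => ∫ t in Ioi (0 : ℝ), w t • K (t • x))
      (∫ t in Ioi (0 : ℝ), (w t * t) • K' (t • x₀)) x₀ := by
  have hpos : 0 < ‖x₀‖ := norm_pos_iff.2 hx₀
  have hKc : Continuous K := continuous_iff_continuousAt.2 fun x => (hK x).continuousAt
  obtain ⟨C, hC⟩ := h₁ (‖x₀‖ / 2) (‖x₀‖ + ‖x₀‖ / 2) (by positivity)
  refine hasFDerivAt_integral_of_dominated_of_fderiv_le
    (F' := fun x t => (w t * t) • K' (t • x)) (bound := fun t => C * (1 + t ^ 2)⁻¹)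
    (Metric.ball_mem_nhds x₀ (half_pos hpos))
    (Filter.Eventually.of_forall fun x => aestronglyMeasurable_radial hw hKc x)
    (h₀.integrableOn hw hKc hx₀)
    (aestronglyMeasurable_radial (hw.mul continuousOn_id) hK' x₀) ?_
    (integrable_inv_one_add_sq.const_mul C).integrableOn ?_
  · filter_upwards [ae_restrict_mem measurableSet_Ioi] with t ht x hx
    rw [Metric.mem_ball, dist_eq_norm] at hx
    have h1 := norm_sub_norm_le x₀ x
    have h2 := norm_sub_norm_le x x₀
    rw [norm_sub_rev] at h1
    exact hC t ht x (by linarith) (by linarith)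
  · refine Filter.Eventually.of_forall fun t x _ => ?_
    have h := ((hK (t • x)).comp x ((hasFDerivAt_id x).const_smul t)).const_smul (w t)
    convert! h using 1
    ext v
    simp [mul_smul]

/-- Schwartz decay of orders `m` and `m + 2` at the point `t • x`; the lower bound `δ ≤ ‖x‖` turns
powers of `‖t • x‖` into powers of `t`. -/
theorem SchwartzMap.radialDecay_pow (H : SchwartzMap E F) (m : ℕ) :
    RadialDecay (fun t => t ^ m) H := by
  refine RadialDecay.of_bounds fun δ R hδ => ?_
  obtain ⟨C₁, -, hC₁⟩ := H.decay m 0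
  obtain ⟨C₂, -, hC₂⟩ := H.decay (m + 2) 0
  have key : ∀ (k : ℕ) (C : ℝ), (∀ x, ‖x‖ ^ k * ‖iteratedFDeriv ℝ 0 H x‖ ≤ C) → ∀ t : ℝ, 0 < t →
      ∀ x : E, δ ≤ ‖x‖ → t ^ k * ‖H (t • x)‖ ≤ C / δ ^ k := by
    intro k C hC t ht x hx
    have := hC (t • x)
    rw [norm_iteratedFDeriv_zero, norm_smul, Real.norm_of_nonneg ht.le, mul_pow] at this
    rw [le_div_iff₀ (by positivity)]
    refine le_trans ?_ this
    have h2 : δ ^ k ≤ ‖x‖ ^ k := pow_le_pow_left₀ hδ.le hx k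
    have h3 : 0 ≤ t ^ k * ‖H (t • x)‖ := by positivity
    nlinarith
  refine ⟨C₁ / δ ^ m, C₂ / δ ^ (m + 2), fun t ht x hx _ => ?_⟩
  have hn : ‖t ^ m • H (t • x)‖ = t ^ m * ‖H (t • x)‖ := by
    rw [norm_smul, Real.norm_of_nonneg (by positivity)]
  rw [hn]
  refine ⟨key m C₁ hC₁ t ht x hx, ?_⟩
  have := key (m + 2) C₂ hC₂ t ht x hx
  rw [pow_add, mul_comm (t ^ m), mul_assoc] at this
  exact this

theorem contDiffOn_succ_of_hasFDerivAt {f : E → F} {f' : E → E →L[ℝ] F} {k : ℕ} {s : Set E}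
    (hs : IsOpen s) (h : ∀ x ∈ s, HasFDerivAt f (f' x) x) (h' : ContDiffOn ℝ k f' s) :
    ContDiffOn ℝ (k + 1 : ℕ) f s := by
  push_cast
  rw [contDiffOn_succ_iff_fderiv_of_isOpen hs]
  refine ⟨fun x hx => (h x hx).differentiableAt.differentiableWithinAt, by simp, ?_⟩
  exact h'.congr fun x hx => (h x hx).fderiv

/-- The derivative is an integral of the same kind, with `m + 1` for `m` and the Schwartz function
`fderiv H` for `H`. The induction on `k` therefore runs over all targets `F` and all `m`. -/
theorem contDiffOn_integral_pow_smul_schwartz (k : ℕ) :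
    ∀ {F : Type} [NormedAddCommGroup F] [NormedSpace ℝ F] (m : ℕ) (H : SchwartzMap E F),
      ContDiffOn ℝ k (fun x => ∫ t in Ioi (0 : ℝ), t ^ m • H (t • x)) {0}ᶜ := by
  have hd : ∀ {F : Type} [NormedAddCommGroup F] [NormedSpace ℝ F] (m : ℕ) (H : SchwartzMap E F),
      ∀ x ∈ ({0}ᶜ : Set E), HasFDerivAt (fun x => ∫ t in Ioi (0 : ℝ), t ^ m • H (t • x))
        (∫ t in Ioi (0 : ℝ), t ^ (m + 1) • (SchwartzMap.fderivCLM ℝ E F H) (t • x)) x := by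
    intro F _ _ m H x hx
    set H' := SchwartzMap.fderivCLM ℝ E F H
    have hd1 : ∀ x, HasFDerivAt H (H' x) x := H.hasFDerivAt
    have := hasFDerivAt_radial_integral (w := fun t => t ^ m) (by fun_prop) hd1
      H'.continuous (SchwartzMap.radialDecay_pow H m)
      (by simpa only [← pow_succ] using SchwartzMap.radialDecay_pow H' (m + 1)) hx
    simpa only [← pow_succ] using this
  induction k with
  | zero =>
    intro F _ _ m H
    simp only [Nat.cast_zero, contDiffOn_zero]
    exact fun x hx => (hd m H x hx).continuousAt.continuousWithinAt
  | succ k ih =>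
    intro F _ _ m H
    exact contDiffOn_succ_of_hasFDerivAt isOpen_compl_singleton (hd m H) (ih _ _)

/-- For an even Schwartz function `H`, the function `∫₀^∞ t⁻² (H 0 - H (t x)) dt` is smooth away
from the origin. -/
theorem contDiffOn_integral_second_difference (H : SchwartzMap E F) (hH : ∀ x, H (-x) = H x) :
    ContDiffOn ℝ ∞ (fun x => ∫ t in Ioi (0 : ℝ), (t ^ 2)⁻¹ • (H 0 - H (t • x))) {0}ᶜ := by
  set H₁ := SchwartzMap.fderivCLM ℝ E F H
  set H₂ := SchwartzMap.fderivCLM ℝ E (E →L[ℝ] F) H₁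
  have hd1 : ∀ x, HasFDerivAt H (H₁ x) x := H.hasFDerivAt
  have hd2 : ∀ x, HasFDerivAt H₁ (H₂ x) x := H₁.hasFDerivAt
  -- Evenness kills the derivative at the origin, so `H 0 - H y` is quadratic in `y` and cancels the
  -- singularity of `t⁻²`.
  have hz : H₁ 0 = 0 := by
    have h1 : HasFDerivAt (fun x => H (-x)) (H₁ 0 ∘L (-ContinuousLinearMap.id ℝ E)) 0 := by
      have := (hd1 (-0))
      have h3 := this.comp (0 : E) (hasFDerivAt_id (0 : E)).neg
      simpa [Function.comp_def] using h3
    simp only [hH] at h1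
    have h2 := h1.unique (hd1 0)
    ext v
    have h3 := congrArg (fun L => L v) h2
    simp only [ContinuousLinearMap.comp_apply, neg_apply,
      ContinuousLinearMap.id_apply, map_neg] at h3
    have h4 : (2 : ℝ) • H₁ 0 v = 0 := by
      rw [two_smul]; nth_rewrite 1 [← h3]; simp
    simpa using h4
  obtain ⟨M, hM0, hM⟩ := H₂.decay 0 0
  obtain ⟨A, hA0, hA⟩ := H.decay 0 0
  obtain ⟨B, hB0, hB⟩ := H₁.decay 1 0
  simp only [pow_zero, one_mul, pow_one, norm_iteratedFDeriv_zero] at hM hA hB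
  have hb1 : ∀ y, ‖H₁ y‖ ≤ M * ‖y‖ := by
    intro y
    have := (convex_univ (𝕜 := ℝ)).norm_image_sub_le_of_norm_hasFDerivWithin_le
      (fun x _ => (hd2 x).hasFDerivWithinAt) (fun x _ => hM x) (mem_univ (0 : E)) (mem_univ y)
    simpa [hz] using this
  have hb0 : ∀ y, ‖H 0 - H y‖ ≤ M * ‖y‖ ^ 2 := by
    intro y
    have := (convex_closedBall (0 : E) ‖y‖).norm_image_sub_le_of_norm_hasFDerivWithin_le
      (f := H) (f' := H₁) (C := M * ‖y‖)
      (fun x _ => (hd1 x).hasFDerivWithinAt) (fun x hx => (hb1 x).trans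
        (mul_le_mul_of_nonneg_left (by simpa using hx) hM0.le))
      (x := 0) (y := y) (by simp) (by simp)
    rw [norm_sub_rev, pow_two, ← mul_assoc]
    simpa using this
  have hw2 : ContinuousOn (fun t : ℝ => (t ^ 2)⁻¹) (Ioi 0) :=
    ContinuousOn.inv₀ (by fun_prop) fun t ht => by have : 0 < t := ht; positivity
  have hw1 : ContinuousOn (fun t : ℝ => t⁻¹) (Ioi 0) :=
    ContinuousOn.inv₀ (by fun_prop) fun t ht => by have : 0 < t := ht; positivity
  have dec0 : RadialDecay (fun t => (t ^ 2)⁻¹) (fun x => H 0 - H x) := by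
    refine RadialDecay.of_bounds fun δ R hδ => ⟨M * R ^ 2, 2 * A, fun t ht x hx hxR => ?_⟩
    have hn : ‖(t ^ 2)⁻¹ • (H 0 - H (t • x))‖ = (t ^ 2)⁻¹ * ‖H 0 - H (t • x)‖ := by
      rw [norm_smul, Real.norm_of_nonneg (by positivity)]
    rw [hn]
    constructor
    · rw [inv_mul_le_iff₀ (by positivity)]
      refine (hb0 _).trans ?_
      rw [norm_smul, Real.norm_of_nonneg ht.le]
      have : ‖x‖ ^ 2 ≤ R ^ 2 := pow_le_pow_left₀ (norm_nonneg _) hxR 2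
      have := mul_le_mul_of_nonneg_left this (show 0 ≤ t ^ 2 * M by positivity)
      linarith
    · rw [← mul_assoc, mul_inv_cancel₀ (by positivity), one_mul]
      exact (norm_sub_le _ _).trans (by linarith [hA 0, hA (t • x)])
  have dec1 : RadialDecay (fun t => t⁻¹) H₁ := by
    refine RadialDecay.of_bounds fun δ R hδ => ⟨M * R, B / δ, fun t ht x hx hxR => ?_⟩
    have hn : ‖t⁻¹ • H₁ (t • x)‖ = t⁻¹ * ‖H₁ (t • x)‖ := by
      rw [norm_smul, Real.norm_of_nonneg (by positivity)]
    rw [hn]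
    constructor
    · rw [inv_mul_le_iff₀ (by positivity)]
      refine (hb1 _).trans ?_
      rw [norm_smul, Real.norm_of_nonneg ht.le]
      have := mul_le_mul_of_nonneg_left hxR (show 0 ≤ t * M by positivity)
      linarith
    · have h1 := hB (t • x)
      rw [norm_smul, Real.norm_of_nonneg ht.le] at h1
      have h2 : t ^ 2 * (t⁻¹ * ‖H₁ (t • x)‖) = t * ‖H₁ (t • x)‖ := by field_simp
      rw [h2, le_div_iff₀ hδ]
      refine le_trans ?_ h1
      have := mul_le_mul_of_nonneg_left hx (show 0 ≤ t * ‖H₁ (t • x)‖ by positivity)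
      linarith
  have dec1' : RadialDecay (fun t => (t ^ 2)⁻¹ * t) (fun x => -H₁ x) := by
    intro δ R hδ
    obtain ⟨C, hC⟩ := dec1 δ R hδ
    refine ⟨C, fun t ht x hx hxR => ?_⟩
    have h1 : (t ^ 2)⁻¹ * t = t⁻¹ := by field_simp
    simp only [h1, smul_neg, norm_neg]
    exact hC t ht x hx hxR
  have dec2 : RadialDecay (fun t => t⁻¹ * t) H₂ := by
    intro δ R hδ
    obtain ⟨C, hC⟩ := SchwartzMap.radialDecay_pow H₂ 0 δ R hδ
    refine ⟨C, fun t ht x hx hxR => ?_⟩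
    have h1 : t⁻¹ * t = t ^ 0 := by field_simp
    simp only [h1]
    exact hC t ht x hx hxR
  -- Each differentiation contributes a factor `t`: two of them remove the weight `t⁻²` and leave a
  -- Schwartz integral with `m = 0`.
  have D0 : ∀ x ∈ ({0}ᶜ : Set E), HasFDerivAt
      (fun x => ∫ t in Ioi (0 : ℝ), (t ^ 2)⁻¹ • (H 0 - H (t • x)))
      (-∫ t in Ioi (0 : ℝ), t⁻¹ • H₁ (t • x)) x := by
    intro x hx
    have := hasFDerivAt_radial_integral hw2 (K := fun x => H 0 - H x) (K' := fun x => -H₁ x)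
      (fun x => (hd1 x).const_sub (H 0)) (H₁.continuous.neg) dec0 dec1' hx
    convert! this using 1
    rw [← integral_neg]
    refine setIntegral_congr_fun measurableSet_Ioi fun t ht => ?_
    have ht' : 0 < t := ht
    have h1 : (t ^ 2)⁻¹ * t = t⁻¹ := by field_simp
    simp only [h1, smul_neg]
  have D1 : ∀ x ∈ ({0}ᶜ : Set E), HasFDerivAt
      (fun x => ∫ t in Ioi (0 : ℝ), t⁻¹ • H₁ (t • x))
      (∫ t in Ioi (0 : ℝ), t ^ 0 • H₂ (t • x)) x := by
    intro x hx
    have := hasFDerivAt_radial_integral hw1 hd2 H₂.continuous dec1 dec2 hx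
    convert! this using 1
    refine setIntegral_congr_fun measurableSet_Ioi fun t ht => ?_
    have ht' : 0 < t := ht
    have h1 : t⁻¹ * t = t ^ 0 := by field_simp
    simp only [h1]
  rw [contDiffOn_infty]
  intro k
  have hk : ContDiffOn ℝ (k + 1 + 1 : ℕ)
      (fun x => ∫ t in Ioi (0 : ℝ), (t ^ 2)⁻¹ • (H 0 - H (t • x))) {0}ᶜ :=
    contDiffOn_succ_of_hasFDerivAt isOpen_compl_singleton D0
      (contDiffOn_succ_of_hasFDerivAt isOpen_compl_singleton D1
        (contDiffOn_integral_pow_smul_schwartz k 0 H₂)).neg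
  exact hk.of_le (by exact_mod_cast (by omega : k ≤ k + 1 + 1))

end RadialIntegral

/-! ### The kernel `|a|` as a cosine integral, and its Fourier form -/

section CosineKernel

open scoped FourierTransform

/-- The constant `∫₀^∞ (1 - cos r) / r² dr`. -/
def cosConst : ℝ := ∫ r in Ioi (0 : ℝ), (r ^ 2)⁻¹ * (1 - Real.cos r)

theorem cosKernel_nonneg (a r : ℝ) : 0 ≤ (r ^ 2)⁻¹ * (1 - Real.cos (a * r)) :=
  mul_nonneg (by positivity) (by linarith [Real.cos_le_one (a * r)])

theorem integrableOn_cosKernel (a : ℝ) :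
    IntegrableOn (fun r => (r ^ 2)⁻¹ * (1 - Real.cos (a * r))) (Ioi 0) := by
  refine Integrable.mono' (integrable_inv_one_add_sq.const_mul (a ^ 2 / 2 + 2)).integrableOn
    (by fun_prop) ?_
  filter_upwards [ae_restrict_mem measurableSet_Ioi] with r hr
  have hr' : 0 < r := hr
  rw [Real.norm_of_nonneg (cosKernel_nonneg a r)]
  refine le_mul_inv_one_add_sq ?_ ?_
  · rw [inv_mul_le_iff₀ (by positivity)]
    have := Real.one_sub_sq_div_two_le_cos (x := a * r)
    nlinarith
  · rw [← mul_assoc, mul_inv_cancel₀ (by positivity), one_mul]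
    linarith [Real.neg_one_le_cos (a * r)]

/-- Substitute `r ↦ |a| r`; the cosine does not see the sign of `a`. -/
theorem integral_cosKernel (a : ℝ) :
    ∫ r in Ioi (0 : ℝ), (r ^ 2)⁻¹ * (1 - Real.cos (a * r)) = |a| * cosConst := by
  rcases eq_or_ne a 0 with rfl | ha
  · simp
  have hpos : 0 < |a| := abs_pos.2 ha
  have h := integral_comp_mul_left_Ioi (fun r => (r ^ 2)⁻¹ * (1 - Real.cos r)) 0 hpos
  rw [mul_zero, smul_eq_mul] at h
  have h2 : ∀ r : ℝ, (r ^ 2)⁻¹ * (1 - Real.cos (a * r)) =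
      |a| ^ 2 * (((|a| * r) ^ 2)⁻¹ * (1 - Real.cos (|a| * r))) := by
    intro r
    have : Real.cos (|a| * r) = Real.cos (a * r) := by
      rcases abs_choice a with h | h <;> simp [h]
    rw [this, mul_pow, mul_inv, ← mul_assoc, ← mul_assoc, mul_inv_cancel₀ (by positivity), one_mul]
  simp_rw [h2]
  rw [integral_const_mul, h, cosConst]
  field_simp

theorem cosConst_pos : 0 < cosConst := by
  have hi := integrableOn_cosKernel 1
  simp only [one_mul] at hi
  have hnn : ∀ r : ℝ, 0 ≤ (r ^ 2)⁻¹ * (1 - Real.cos r) := fun r => by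
    simpa using cosKernel_nonneg 1 r
  unfold cosConst
  rw [setIntegral_pos_iff_support_of_nonneg_ae (Filter.Eventually.of_forall hnn) hi]
  have hsub : Ioo (0 : ℝ) 1 ⊆
      (Function.support fun r : ℝ => (r ^ 2)⁻¹ * (1 - Real.cos r)) ∩ Ioi 0 := by
    rintro r ⟨h0, h1⟩
    refine ⟨?_, h0⟩
    have hc : Real.cos r < 1 := by
      have := Real.cos_lt_cos_of_nonneg_of_le_pi_div_two le_rfl
        (by linarith [Real.pi_gt_three]) h0
      simpa using this
    have : 0 < (r ^ 2)⁻¹ * (1 - Real.cos r) := mul_pos (by positivity) (by linarith)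
    exact this.ne'
  exact lt_of_lt_of_le (by simp) (measure_mono hsub)

variable {E : Type} [NormedAddCommGroup E] [InnerProductSpace ℝ E] [FiniteDimensional ℝ E]
  [MeasurableSpace E] [BorelSpace E]

theorem fourier_neg_of_even {Φ : E → ℂ} (hΦ : ∀ x, Φ (-x) = Φ x) (w : E) : 𝓕 Φ (-w) = 𝓕 Φ w := by
  rw [Real.fourier_eq', Real.fourier_eq',
    ← integral_neg_eq_self (fun v => Complex.exp (↑(-2 * Real.pi * inner ℝ v w) * Complex.I) • Φ v)]
  simp [hΦ]

theorem fourier_eq_integral_cos {Φ : E → ℂ} (hi : Integrable Φ) (hΦ : ∀ x, Φ (-x) = Φ x) (w : E) :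
    𝓕 Φ w = ∫ v, Real.cos (2 * Real.pi * inner ℝ v w) • Φ v := by
  have hint : ∀ u : E, Integrable
      (fun v => Complex.exp (↑(-2 * Real.pi * inner ℝ v u) * Complex.I) • Φ v) := fun u => by
    have hm : AEStronglyMeasurable
        (fun v : E => Complex.exp (↑(-2 * Real.pi * inner ℝ v u) * Complex.I)) volume := by
      fun_prop
    exact hi.bdd_smul 1 hm (Filter.Eventually.of_forall fun v =>
      (Complex.norm_exp_ofReal_mul_I _).le)
  -- Averaging over `w` and `-w` replaces the exponential by a cosine.
  have h : 𝓕 Φ w = (1 / 2 : ℂ) * (𝓕 Φ w + 𝓕 Φ (-w)) := by rw [fourier_neg_of_even hΦ]; ring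
  rw [h, Real.fourier_eq', Real.fourier_eq', ← integral_add (hint w) (hint (-w)),
    ← integral_const_mul]
  refine integral_congr_ae (Filter.Eventually.of_forall fun v => ?_)
  simp only [inner_neg_right, smul_eq_mul, Complex.real_smul, Complex.ofReal_cos]
  rw [Complex.cos]
  push_cast
  ring_nf

/-- The integral of `|⟨ξ, x⟩| Φ(ξ)` in terms of the Fourier transform of the even function `Φ`. -/
theorem integral_abs_inner_smul_eq (Φ : SchwartzMap E ℂ) (hΦ : ∀ x, Φ (-x) = Φ x) (x : E) :
    (2 * Real.pi * cosConst) • ∫ ξ, |inner ℝ x ξ| • Φ ξ =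
      ∫ r in Ioi (0 : ℝ), (r ^ 2)⁻¹ • (𝓕 Φ 0 - 𝓕 Φ (r • x)) := by
  set f : ℝ × E → ℂ := fun p =>
    ((p.1 ^ 2)⁻¹ * (1 - Real.cos (2 * Real.pi * inner ℝ x p.2 * p.1))) • Φ p.2 with hf
  have hnorm : ∀ r ξ, ‖f (r, ξ)‖ =
      ((r ^ 2)⁻¹ * (1 - Real.cos (2 * Real.pi * inner ℝ x ξ * r))) * ‖Φ ξ‖ := fun r ξ => by
    simp only [hf]
    rw [norm_smul, Real.norm_of_nonneg (cosKernel_nonneg _ _)]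
  have habs : Integrable (fun ξ => |inner ℝ x ξ| * ‖Φ ξ‖) := by
    refine ((Φ.integrable_pow_mul volume 1).const_mul ‖x‖).mono' (by fun_prop) ?_
    refine Filter.Eventually.of_forall fun ξ => ?_
    rw [Real.norm_of_nonneg (by positivity), pow_one, ← mul_assoc]
    exact mul_le_mul_of_nonneg_right (abs_real_inner_le_norm x ξ) (norm_nonneg _)
  -- The kernel is nonnegative, so integrating the norm over `r` first gives a multiple of `|⟨x, ξ⟩|
  -- ‖Φ ξ‖`, which is integrable. This justifies Fubini.
  have hfint : Integrable f ((volume.restrict (Ioi 0)).prod volume) := by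
    rw [integrable_prod_iff']
    · refine ⟨Filter.Eventually.of_forall fun ξ =>
        (integrableOn_cosKernel (2 * Real.pi * inner ℝ x ξ)).smul_const (Φ ξ), ?_⟩
      simp_rw [hnorm, integral_mul_const, integral_cosKernel]
      convert! habs.const_mul (2 * Real.pi * cosConst) using 2 with ξ
      rw [abs_mul, abs_of_pos Real.two_pi_pos]
      ring
    · refine Measurable.aestronglyMeasurable ?_
      have := Φ.continuous.measurable
      fun_prop
  have hswap := integral_integral_swap (f := fun r ξ => f (r, ξ)) hfint
  have hR : ∀ r : ℝ, ∫ ξ, f (r, ξ) = (r ^ 2)⁻¹ • (𝓕 Φ 0 - 𝓕 Φ (r • x)) := by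
    intro r
    rw [SchwartzMap.fourier_coe, fourier_eq_integral_cos Φ.integrable hΦ,
      fourier_eq_integral_cos Φ.integrable hΦ, ← integral_sub, ← integral_smul]
    · refine integral_congr_ae (Filter.Eventually.of_forall fun ξ => ?_)
      simp only [hf, inner_zero_right, mul_zero, Real.cos_zero, inner_smul_right, mul_smul,
        real_inner_comm x ξ, sub_smul]
      ring_nf
    · simpa using Φ.integrable
    · have hm : AEStronglyMeasurable
          (fun v : E => Real.cos (2 * Real.pi * inner ℝ v (r • x))) volume := by fun_prop
      exact Φ.integrable.bdd_smul 1 hm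
        (Filter.Eventually.of_forall fun v => Real.abs_cos_le_one _)
  have hL : ∀ ξ : E, ∫ r in Ioi (0 : ℝ), f (r, ξ) =
      (2 * Real.pi * cosConst) • (|inner ℝ x ξ| • Φ ξ) := by
    intro ξ
    simp only [hf]
    rw [integral_smul_const, integral_cosKernel, abs_mul, abs_of_pos Real.two_pi_pos, smul_smul]
    ring_nf
  simp_rw [hR, hL] at hswap
  rw [hswap, integral_smul]

end CosineKernel

/-! ### Polar coordinates -/

section Polar

variable {E F : Type*} [NormedAddCommGroup E] [NormedSpace ℝ E] [FiniteDimensional ℝ E]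
  [Nontrivial E] [MeasurableSpace E] [BorelSpace E] [NormedAddCommGroup F] [NormedSpace ℝ F]

/-- Integration in polar coordinates. -/
theorem integral_eq_integral_toSphere (μ : Measure E) [μ.IsAddHaarMeasure] {g : E → F}
    (hg : Integrable g μ) :
    ∫ x, g x ∂μ = ∫ y : Metric.sphere (0 : E) 1, ∫ t in Ioi (0 : ℝ),
      t ^ (Module.finrank ℝ E - 1) • g (t • (y : E)) ∂volume ∂μ.toSphere := by
  have hmp := μ.measurePreserving_homeomorphUnitSphereProd
  have hemb := (homeomorphUnitSphereProd E).measurableEmbedding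
  set G : Metric.sphere (0 : E) 1 × Ioi (0 : ℝ) → F := fun p => g ((p.2 : ℝ) • (p.1 : E)) with hG
  have hGe : ∀ x : ({0}ᶜ : Set E), G (homeomorphUnitSphereProd E x) = g x := fun x => by
    have := homeomorphUnitSphereProd_symm_apply_coe E (homeomorphUnitSphereProd E x)
    rw [Homeomorph.symm_apply_apply] at this
    simp only [hG, ← this]
  have hGi : Integrable G (μ.toSphere.prod (Measure.volumeIoiPow (Module.finrank ℝ E - 1))) := by
    rw [← hmp.integrable_comp_emb hemb]
    have h : G ∘ homeomorphUnitSphereProd E = g ∘ ((↑) : ({0}ᶜ : Set E) → E) := funext hGe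
    rw [h, ← integrableOn_iff_comap_subtypeVal (measurableSet_singleton _).compl]
    exact hg.integrableOn
  calc ∫ x, g x ∂μ = ∫ x : ({(0)}ᶜ : Set E), g x ∂(μ.comap (↑)) := by
        rw [integral_subtype_comap (measurableSet_singleton _).compl g, restrict_compl_singleton]
    _ = ∫ p, G p ∂μ.toSphere.prod (Measure.volumeIoiPow (Module.finrank ℝ E - 1)) := by
        rw [← hmp.integral_comp hemb]
        simp only [hGe]
    _ = _ := by
        rw [integral_prod _ hGi]
        refine integral_congr_ae (Filter.Eventually.of_forall fun y => ?_)
        simp only [Measure.volumeIoiPow, ENNReal.ofReal]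
        rw [integral_withDensity_eq_integral_smul (by fun_prop),
          integral_subtype_comap measurableSet_Ioi fun a : ℝ =>
            Real.toNNReal (a ^ (Module.finrank ℝ E - 1)) • g (a • (y : E))]
        refine setIntegral_congr_fun measurableSet_Ioi fun t ht => ?_
        simp only [NNReal.smul_def, Real.coe_toNNReal _ (pow_nonneg (le_of_lt ht) _)]

end Polar

/-! ### The uniform measure on the sphere -/

section UniformMeasure

variable {n : ℕ}

theorem continuous_absInner : Continuous (Function.uncurry (absInner (n := n))) := by
  unfold absInner Function.uncurry
  fun_prop

theorem absInner_comm (x y : Sph n) : absInner x y = absInner y x := by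
  simp only [absInner, real_inner_comm]

theorem absInner_neg_left (x y : Sph n) : absInner (-x) y = absInner x y := by
  simp [absInner]

theorem absInner_neg_right (x y : Sph n) : absInner x (-y) = absInner x y := by
  simp [absInner]

theorem toSphere_univ_ne_zero (n : ℕ) :
    (volume : Measure (EuclideanSpace ℝ (Fin (n + 1)))).toSphere univ ≠ 0 := by
  rw [Ne, Measure.measure_univ_eq_zero]
  exact Measure.toSphere_ne_zero _

theorem toSphere_univ_ne_top (n : ℕ) :
    (volume : Measure (EuclideanSpace ℝ (Fin (n + 1)))).toSphere univ ≠ ⊤ :=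
  measure_ne_top _ _

instance (n : ℕ) : IsProbabilityMeasure (unif n) where
  measure_univ := by
    rw [unif, Measure.smul_apply, smul_eq_mul,
      ENNReal.inv_mul_cancel (toSphere_univ_ne_zero n) (toSphere_univ_ne_top n)]

instance (n : ℕ) : (unif n).IsOpenPosMeasure :=
  Measure.isOpenPosMeasure_smul _ (ENNReal.inv_ne_zero.2 (toSphere_univ_ne_top n))

/-- The surface area of the unit sphere. -/
def area (n : ℕ) : ℝ := ((volume : Measure (EuclideanSpace ℝ (Fin (n + 1)))).toSphere univ).toReal

theorem area_pos (n : ℕ) : 0 < area n :=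
  ENNReal.toReal_pos (toSphere_univ_ne_zero n) (toSphere_univ_ne_top n)

theorem integral_toSphere_eq {F : Type*} [NormedAddCommGroup F] [NormedSpace ℝ F]
    (g : Sph n → F) :
    ∫ y, g y ∂(volume : Measure (EuclideanSpace ℝ (Fin (n + 1)))).toSphere =
      area n • ∫ y, g y ∂(unif n) := by
  rw [unif, integral_smul_measure, ENNReal.toReal_inv, smul_smul]
  change _ = (area n * (area n)⁻¹) • _
  rw [mul_inv_cancel₀ (area_pos n).ne', one_smul]

theorem measurePreserving_neg_unif (n : ℕ) :
    MeasurePreserving (fun x : Sph n => -x) (unif n) (unif n) := by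
  have hm : Measurable (fun x : Sph n => -x) := continuous_neg.measurable
  have h : MeasurePreserving (fun x : Sph n => -x)
      (volume : Measure (EuclideanSpace ℝ (Fin (n + 1)))).toSphere
      (volume : Measure (EuclideanSpace ℝ (Fin (n + 1)))).toSphere := by
    refine ⟨hm, Measure.ext fun s hs => ?_⟩
    rw [Measure.map_apply hm hs, Measure.toSphere_apply' _ (hm hs), Measure.toSphere_apply' _ hs]
    -- The surface measure of a set is a multiple of the volume of the cone over it, and volume is
    -- invariant under reflection.
    congr 1
    rw [← Measure.measure_preimage_neg]
    congr 1
    ext v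
    simp only [Set.mem_smul, mem_preimage, mem_image]
    constructor
    · rintro ⟨t, ht, _, ⟨y, hy, rfl⟩, h⟩
      exact ⟨t, ht, _, ⟨-y, hy, rfl⟩, by simp [h]⟩
    · rintro ⟨t, ht, _, ⟨y, hy, rfl⟩, rfl⟩
      exact ⟨t, ht, _, ⟨-y, by simpa using hy, rfl⟩, by simp⟩
  exact h.smul_measure _

theorem integral_comp_neg_unif (g : Sph n → ℝ) : ∫ x, g (-x) ∂(unif n) = ∫ x, g x ∂(unif n) :=
  (measurePreserving_neg_unif n).integral_comp
    (Homeomorph.neg (Sph n)).measurableEmbedding g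

theorem integrable_of_continuous {ν : Measure (Sph n)} [IsFiniteMeasure ν] {F : Type*}
    [NormedAddCommGroup F] {g : Sph n → F} (hg : Continuous g) : Integrable g ν :=
  hg.integrable_of_hasCompactSupport (HasCompactSupport.of_compactSpace g)

theorem eq_zero_of_integral_sq {g : Sph n → ℝ} (hg : Continuous g)
    (h : ∫ x, g x * g x ∂(unif n) = 0) : g = 0 := by
  rw [integral_eq_zero_iff_of_nonneg (fun x => mul_self_nonneg (g x))
    (integrable_of_continuous (hg.mul hg))] at h
  have := ((hg.mul hg).ae_eq_iff_eq (unif n) continuous_zero).1 h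
  funext x
  exact mul_self_eq_zero.1 (congrFun this x)

end UniformMeasure

/-! ### Algebra and symmetry of the cosine transform -/

section Operator

variable {n : ℕ}

theorem integrable_absInner_mul {ν : Measure (Sph n)} [IsFiniteMeasure ν] {φ : Sph n → ℝ}
    (hφ : Continuous φ) (x : Sph n) : Integrable (fun y => absInner x y * φ y) ν :=
  integrable_of_continuous ((continuous_absInner.comp (by fun_prop : Continuous
    fun y => (x, y))).mul hφ)

theorem T_add {φ ψ : Sph n → ℝ} (hφ : Continuous φ) (hψ : Continuous ψ) :
    T (φ + ψ) = T φ + T ψ := by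
  funext x
  simp only [T, Pi.add_apply, mul_add]
  exact integral_add (integrable_absInner_mul hφ x) (integrable_absInner_mul hψ x)

theorem T_smul (c : ℝ) (φ : Sph n → ℝ) : T (c • φ) = c • T φ := by
  funext x
  simp only [T, Pi.smul_apply, smul_eq_mul, ← integral_const_mul]
  congr 1
  funext y
  ring

theorem isEvenFun_T (φ : Sph n → ℝ) : IsEvenFun (T φ) := fun x => by
  simp only [T, absInner_neg_left]

/-- Fubini's theorem for the cosine kernel. -/
theorem integral_mul_integral_absInner (ν : Measure (Sph n)) [IsFiniteMeasure ν] {ψ : Sph n → ℝ}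
    (hψ : Continuous ψ) :
    ∫ x, ψ x * (∫ w, absInner w x ∂ν) ∂(unif n) = ∫ w, T ψ w ∂ν := by
  have h := integral_integral_swap_of_hasCompactSupport (f := fun x w => ψ x * absInner w x)
    (μ := unif n) (ν := ν)
    (by
      have := continuous_absInner (n := n)
      exact (hψ.comp continuous_fst).mul (this.comp continuous_swap))
    (HasCompactSupport.of_compactSpace _)
  simp_rw [integral_const_mul] at h
  rw [h]
  simp only [T, mul_comm]

theorem integral_mul_T_symm {φ ψ : Sph n → ℝ} (hφ : Continuous φ) (hψ : Continuous ψ) :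
    ∫ x, ψ x * T φ x ∂(unif n) = ∫ x, T ψ x * φ x ∂(unif n) := by
  have h := integral_integral_swap_of_hasCompactSupport
    (f := fun x w => ψ x * (absInner x w * φ w)) (μ := unif n) (ν := unif n)
    (by
      have := continuous_absInner (n := n)
      exact (hψ.comp continuous_fst).mul (this.mul (hφ.comp continuous_snd)))
    (HasCompactSupport.of_compactSpace _)
  simp_rw [integral_const_mul] at h
  unfold T
  rw [h]
  refine integral_congr_ae (Filter.Eventually.of_forall fun w => ?_)
  simp only
  rw [← integral_mul_const]
  refine integral_congr_ae (Filter.Eventually.of_forall fun x => ?_)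
  simp only [absInner_comm w x]
  ring

end Operator

/-! ### Smooth even functions and their extensions to an annulus -/

section SmoothEven

variable {n : ℕ}

theorem continuous_of_mem_smoothEven {φ : Sph n → ℝ} (h : φ ∈ smoothEven n) : Continuous φ :=
  h.1.continuous

theorem zero_mem_smoothEven : (0 : Sph n → ℝ) ∈ smoothEven n :=
  ⟨contMDiff_const, fun _ => rfl⟩

theorem add_mem_smoothEven {φ ψ : Sph n → ℝ} (hφ : φ ∈ smoothEven n) (hψ : ψ ∈ smoothEven n) :
    φ + ψ ∈ smoothEven n :=
  ⟨hφ.1.add hψ.1, fun x => by simp [hφ.2 x, hψ.2 x]⟩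

theorem smul_mem_smoothEven (c : ℝ) {φ : Sph n → ℝ} (hφ : φ ∈ smoothEven n) :
    c • φ ∈ smoothEven n :=
  ⟨(contMDiff_const (c := c)).mul hφ.1, fun x => by simp [hφ.2 x]⟩

theorem contMDiff_neg_sph : ContMDiff (𝓡 n) (𝓡 n) ∞ fun x : Sph n => -x :=
  haveI := Fact.mk (@finrank_euclideanSpace_fin ℝ _ (n + 1))
  contMDiff_neg_sphere

theorem contMDiff_coe_sph :
    ContMDiff (𝓡 n) 𝓘(ℝ, EuclideanSpace ℝ (Fin (n + 1))) ∞
      ((↑) : Sph n → EuclideanSpace ℝ (Fin (n + 1))) :=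
  haveI := Fact.mk (@finrank_euclideanSpace_fin ℝ _ (n + 1))
  contMDiff_coe_sphere

theorem contMDiff_comp_coe {g : EuclideanSpace ℝ (Fin (n + 1)) → ℝ}
    (hg : ContDiffOn ℝ ∞ g {0}ᶜ) : ContMDiff (𝓡 n) 𝓘(ℝ, ℝ) ∞ fun x : Sph n => g x := by
  intro x
  have hx : (x : EuclideanSpace ℝ (Fin (n + 1))) ≠ 0 := ne_zero_of_mem_unit_sphere x
  have h := (hg.contDiffAt (isOpen_compl_singleton.mem_nhds hx)).contMDiffAt
  exact h.comp x contMDiff_coe_sph.contMDiffAt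

/-- The radial projection onto the unit sphere (with an arbitrary value at the origin). -/
def radialProj (x : EuclideanSpace ℝ (Fin (n + 1))) : Sph n :=
  if h : x = 0 then Classical.choice (NormedSpace.sphere_nonempty.2 zero_le_one).to_subtype
  else ⟨‖x‖⁻¹ • x, by simp [norm_smul, h]⟩

theorem coe_radialProj {x : EuclideanSpace ℝ (Fin (n + 1))} (hx : x ≠ 0) :
    (radialProj x : EuclideanSpace ℝ (Fin (n + 1))) = ‖x‖⁻¹ • x := by
  simp [radialProj, hx]

theorem radialProj_neg {x : EuclideanSpace ℝ (Fin (n + 1))} (hx : x ≠ 0) :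
    radialProj (-x) = -radialProj x := by
  ext1
  rw [coe_radialProj (neg_ne_zero.2 hx)]
  simp [coe_radialProj hx]

theorem radialProj_smul {t : ℝ} (ht : 0 < t) (y : Sph n) :
    radialProj (t • (y : EuclideanSpace ℝ (Fin (n + 1)))) = y := by
  have hy : (y : EuclideanSpace ℝ (Fin (n + 1))) ≠ 0 := ne_zero_of_mem_unit_sphere y
  ext1
  rw [coe_radialProj (smul_ne_zero ht.ne' hy), norm_smul, norm_eq_of_mem_sphere, mul_one,
    Real.norm_of_nonneg ht.le, smul_smul, inv_mul_cancel₀ ht.ne', one_smul]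

theorem contMDiffAt_radialProj {x : EuclideanSpace ℝ (Fin (n + 1))} (hx : x ≠ 0) :
    ContMDiffAt 𝓘(ℝ, EuclideanSpace ℝ (Fin (n + 1))) (𝓡 n) ∞ (radialProj (n := n)) x := by
  have := Fact.mk (@finrank_euclideanSpace_fin ℝ _ (n + 1))
  let U : TopologicalSpace.Opens (EuclideanSpace ℝ (Fin (n + 1))) := ⟨{0}ᶜ, isOpen_compl_singleton⟩
  have hU : ∀ y : U, (y : EuclideanSpace ℝ (Fin (n + 1))) ≠ 0 := fun y => y.2
  have hf : ContMDiff 𝓘(ℝ, EuclideanSpace ℝ (Fin (n + 1)))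
      𝓘(ℝ, EuclideanSpace ℝ (Fin (n + 1))) ∞
      (fun y : U => ‖(y : EuclideanSpace ℝ (Fin (n + 1)))‖⁻¹ •
        (y : EuclideanSpace ℝ (Fin (n + 1)))) := by
    intro y
    refine (contMDiffAt_subtype_iff (f := fun y : EuclideanSpace ℝ (Fin (n + 1)) =>
      ‖y‖⁻¹ • y)).2 (ContDiffAt.contMDiffAt ?_)
    exact ((contDiffAt_norm ℝ (hU y)).inv (norm_ne_zero_iff.2 (hU y))).smul contDiffAt_id
  have hf' : ∀ y : U, ‖(y : EuclideanSpace ℝ (Fin (n + 1)))‖⁻¹ •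
      (y : EuclideanSpace ℝ (Fin (n + 1))) ∈ Metric.sphere (0 : EuclideanSpace ℝ (Fin (n + 1))) 1 :=
    fun y => by simp [norm_smul, hU y]
  have h := hf.codRestrict_sphere (n := n) hf'
  have h2 : (Set.codRestrict _ _ hf' : U → Sph n) = fun y : U => radialProj (y : _) := by
    funext y
    ext1
    rw [coe_radialProj (hU y)]
    rfl
  rw [h2] at h
  exact contMDiffAt_subtype_iff.1 (h ⟨x, hx⟩)

/-- A smooth bump function on the line around `1`, vanishing near `0`. -/
def bump : ContDiffBump (1 : ℝ) := ⟨1 / 4, 1 / 2, by norm_num, by norm_num⟩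

theorem bump_eq_zero {t : ℝ} (ht : t ≤ 1 / 2 ∨ 3 / 2 ≤ t) : bump t = 0 := by
  apply bump.zero_of_le_dist
  rw [Real.dist_eq]
  change 1 / 2 ≤ |t - 1|
  rcases ht with h | h
  · rw [abs_of_nonpos (by linarith)]; linarith
  · rw [abs_of_nonneg (by linarith)]; linarith

/-- Applied with weights `t ^ (n + 1)` and `t⁻²`, this makes the constants in the smoothness and
inversion formulas nonzero. -/
theorem integral_mul_bump_pos {w : ℝ → ℝ} (hw : ContinuousOn w (Ioi 0))
    (hpos : ∀ t, 0 < t → 0 < w t) : 0 < ∫ t in Ioi (0 : ℝ), w t * bump t := by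
  have hi : IntegrableOn (fun t => w t * bump t) (Ioi 0) := by
    have h1 : IntegrableOn (fun t => w t * bump t) (Icc (1 / 2) (3 / 2)) := by
      refine ContinuousOn.integrableOn_compact isCompact_Icc ?_
      refine ContinuousOn.mul (hw.mono fun t ht => ?_) bump.continuous.continuousOn
      have := ht.1
      exact (by linarith : (0 : ℝ) < t)
    refine h1.of_forall_sdiff_eq_zero measurableSet_Ioi fun t ht => ?_
    rw [bump_eq_zero, mul_zero]
    by_contra! h
    exact ht.2 ⟨h.1.le, h.2.le⟩
  have hnn : 0 ≤ᵐ[volume.restrict (Ioi 0)] fun t => w t * bump t := by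
    filter_upwards [ae_restrict_mem measurableSet_Ioi] with t ht
    exact mul_nonneg (hpos t ht).le bump.nonneg
  rw [setIntegral_pos_iff_support_of_nonneg_ae hnn hi]
  have hsub : Ioo (3 / 4 : ℝ) 1 ⊆ (Function.support fun t => w t * bump t) ∩ Ioi 0 := by
    rintro t ⟨h0, h1⟩
    have ht : 0 < t := by linarith
    refine ⟨?_, ht⟩
    have hb : bump t = 1 := by
      apply bump.one_of_mem_closedBall
      rw [Metric.mem_closedBall, Real.dist_eq, abs_le]
      change -(1 / 4 : ℝ) ≤ t - 1 ∧ t - 1 ≤ 1 / 4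
      constructor <;> linarith
    simp [Function.mem_support, hb, (hpos t ht).ne']
  refine lt_of_lt_of_le ?_ (measure_mono hsub)
  rw [Real.volume_Ioo]
  norm_num

/-- The extension of a function on the sphere to a function on the whole space that is supported
in an annulus. -/
def annulusExt (φ : Sph n → ℝ) (x : EuclideanSpace ℝ (Fin (n + 1))) : ℂ :=
  ((bump ‖x‖ * φ (radialProj x) : ℝ) : ℂ)

theorem annulusExt_smul (φ : Sph n → ℝ) {t : ℝ} (ht : 0 < t) (y : Sph n) :
    annulusExt φ (t • (y : EuclideanSpace ℝ (Fin (n + 1)))) = ((bump t * φ y : ℝ) : ℂ) := by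
  rw [annulusExt, radialProj_smul ht, norm_smul, norm_eq_of_mem_sphere, mul_one,
    Real.norm_of_nonneg ht.le]

theorem annulusExt_zero (φ : Sph n → ℝ) : annulusExt φ 0 = 0 := by
  rw [annulusExt, norm_zero, bump_eq_zero (by norm_num)]
  simp

theorem annulusExt_neg {φ : Sph n → ℝ} (hφ : IsEvenFun φ) (x : EuclideanSpace ℝ (Fin (n + 1))) :
    annulusExt φ (-x) = annulusExt φ x := by
  rcases eq_or_ne x 0 with rfl | hx
  · simp
  · rw [annulusExt, annulusExt, radialProj_neg hx, hφ, norm_neg]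

theorem hasCompactSupport_annulusExt (φ : Sph n → ℝ) : HasCompactSupport (annulusExt φ) := by
  refine HasCompactSupport.intro (isCompact_closedBall 0 (3 / 2)) fun x hx => ?_
  rw [Metric.mem_closedBall, dist_zero_right, not_le] at hx
  rw [annulusExt, bump_eq_zero (Or.inr hx.le)]
  simp

theorem contDiff_annulusExt {φ : Sph n → ℝ} (hφ : ContMDiff (𝓡 n) 𝓘(ℝ, ℝ) ∞ φ) :
    ContDiff ℝ ∞ (annulusExt φ) := by
  rw [contDiff_iff_contDiffAt]
  intro x
  rcases eq_or_ne x 0 with rfl | hx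
  · have h : annulusExt φ =ᶠ[nhds 0] fun _ => 0 := by
      filter_upwards [Metric.ball_mem_nhds (0 : EuclideanSpace ℝ (Fin (n + 1)))
        (show (0 : ℝ) < 1 / 2 by norm_num)] with x hx
      rw [Metric.mem_ball, dist_zero_right] at hx
      rw [annulusExt, bump_eq_zero (Or.inl hx.le)]
      simp
    exact contDiffAt_const.congr_of_eventuallyEq h
  · have h1 : ContDiffAt ℝ ∞ (fun x => φ (radialProj x)) x :=
      (hφ.contMDiffAt.comp x (contMDiffAt_radialProj hx)).contDiffAt
    have h2 : ContDiffAt ℝ ∞ (fun x : EuclideanSpace ℝ (Fin (n + 1)) => bump ‖x‖) x :=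
      (bump.contDiff.contDiffAt).comp x (contDiffAt_norm ℝ hx)
    exact Complex.ofRealCLM.contDiff.contDiffAt.comp x (h2.mul h1)

/-- `annulusExt` of a smooth function as a Schwartz function. -/
def annulusSchwartz (φ : Sph n → ℝ) (hφ : ContMDiff (𝓡 n) 𝓘(ℝ, ℝ) ∞ φ) :
    SchwartzMap (EuclideanSpace ℝ (Fin (n + 1))) ℂ :=
  (hasCompactSupport_annulusExt φ).toSchwartzMap (contDiff_annulusExt hφ)

theorem annulusSchwartz_apply (φ : Sph n → ℝ) (hφ : ContMDiff (𝓡 n) 𝓘(ℝ, ℝ) ∞ φ)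
    (x : EuclideanSpace ℝ (Fin (n + 1))) : annulusSchwartz φ hφ x = annulusExt φ x := rfl

end SmoothEven

/-! ### Bijectivity of the cosine transform -/

section Inversion

open scoped FourierTransform

variable {n : ℕ}

/-- The radial moment `y ↦ ∫₀^∞ t^d Φ(t y) dt` on the unit sphere of `ℝ^d`. -/
def radialMoment (Φ : SchwartzMap (EuclideanSpace ℝ (Fin (n + 1))) ℂ) (y : Sph n) : ℝ :=
  (∫ t in Ioi (0 : ℝ), t ^ (n + 1) • Φ (t • (y : EuclideanSpace ℝ (Fin (n + 1))))).re

theorem radialMoment_mem_smoothEven (Φ : SchwartzMap (EuclideanSpace ℝ (Fin (n + 1))) ℂ)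
    (hΦ : ∀ x, Φ (-x) = Φ x) : radialMoment Φ ∈ smoothEven n := by
  constructor
  · refine contMDiff_comp_coe (g := fun x =>
      (∫ t in Ioi (0 : ℝ), t ^ (n + 1) • Φ (t • x)).re) ?_
    refine Complex.reCLM.contDiff.comp_contDiffOn ?_
    rw [contDiffOn_infty]
    exact fun k => contDiffOn_integral_pow_smul_schwartz k (n + 1) Φ
  · intro y
    simp only [radialMoment, Metric.sphere, coe_neg_sphere, smul_neg, hΦ]

/-- The cosine transform of a radial moment in terms of the Fourier transform. -/
theorem T_radialMoment (Φ : SchwartzMap (EuclideanSpace ℝ (Fin (n + 1))) ℂ)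
    (hΦ : ∀ x, Φ (-x) = Φ x) (x : Sph n) :
    2 * Real.pi * cosConst * area n * T (radialMoment Φ) x =
      (∫ r in Ioi (0 : ℝ), (r ^ 2)⁻¹ •
        (𝓕 Φ 0 - 𝓕 Φ (r • (x : EuclideanSpace ℝ (Fin (n + 1)))))).re := by
  have hint : Integrable
      (fun ξ => |inner ℝ (x : EuclideanSpace ℝ (Fin (n + 1))) ξ| • Φ ξ) := by
    refine (Φ.integrable_pow_mul volume 1).mono' (by fun_prop) ?_
    refine Filter.Eventually.of_forall fun ξ => ?_
    rw [norm_smul, pow_one, Real.norm_eq_abs, abs_abs]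
    refine mul_le_mul_of_nonneg_right ?_ (norm_nonneg _)
    have := abs_real_inner_le_norm (x : EuclideanSpace ℝ (Fin (n + 1))) ξ
    rwa [norm_eq_of_mem_sphere, one_mul] at this
  have hcont : Continuous fun y : Sph n =>
      ∫ t in Ioi (0 : ℝ), t ^ (n + 1) • Φ (t • (y : EuclideanSpace ℝ (Fin (n + 1)))) :=
    (contDiffOn_integral_pow_smul_schwartz 0 (n + 1) Φ).continuousOn.comp_continuous
      continuous_subtype_val fun y => ne_zero_of_mem_unit_sphere y
  have hpolar := integral_eq_integral_toSphere volume hint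
  rw [finrank_euclideanSpace_fin, Nat.add_sub_cancel, integral_toSphere_eq] at hpolar
  -- Homogeneity of `|⟨x, ·⟩|` supplies the extra factor `t` that raises the Jacobian `t ^ n` to the
  -- weight of `radialMoment`.
  have hin : ∀ y : Sph n, ∫ t in Ioi (0 : ℝ), t ^ n •
      |inner ℝ (x : EuclideanSpace ℝ (Fin (n + 1))) (t • (y : EuclideanSpace ℝ (Fin (n + 1))))| •
        Φ (t • (y : EuclideanSpace ℝ (Fin (n + 1)))) =
      absInner x y •
        ∫ t in Ioi (0 : ℝ), t ^ (n + 1) • Φ (t • (y : EuclideanSpace ℝ (Fin (n + 1)))) := by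
    intro y
    rw [← integral_smul]
    refine setIntegral_congr_fun measurableSet_Ioi fun t ht => ?_
    have ht' : 0 < t := ht
    simp only [inner_smul_right, abs_mul, abs_of_pos ht', smul_smul, absInner]
    congr 1
    ring
  simp_rw [hin] at hpolar
  have hkey := integral_abs_inner_smul_eq Φ hΦ (x : EuclideanSpace ℝ (Fin (n + 1)))
  rw [← hkey, hpolar, Complex.smul_re, Complex.smul_re]
  have hre : (∫ y, absInner x y • (∫ t in Ioi (0 : ℝ), t ^ (n + 1) •
      Φ (t • (y : EuclideanSpace ℝ (Fin (n + 1))))) ∂(unif n)).re = T (radialMoment Φ) x := by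
    have h1 : Integrable (fun y => absInner x y • ∫ t in Ioi (0 : ℝ), t ^ (n + 1) •
        Φ (t • (y : EuclideanSpace ℝ (Fin (n + 1))))) (unif n) :=
      integrable_of_continuous ((continuous_absInner.comp (by fun_prop : Continuous
        fun y => (x, y))).smul hcont)
    rw [← Complex.reCLM_apply, ← Complex.reCLM.integral_comp_comm h1]
    simp [T, radialMoment]
  rw [hre, smul_eq_mul, smul_eq_mul]
  ring

/-- The annular extension of `φ` has radial moment `A • φ`, so `T φ` is a multiple of the Fourier
side of `T_radialMoment`, which is smooth off the origin. -/
theorem T_mem_smoothEven {φ : Sph n → ℝ} (hφ : φ ∈ smoothEven n) : T φ ∈ smoothEven n := by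
  refine ⟨?_, isEvenFun_T φ⟩
  set Φ := annulusSchwartz φ hφ.1 with hΦ
  have heven : ∀ x, Φ (-x) = Φ x := annulusExt_neg hφ.2
  set A : ℝ := ∫ t in Ioi (0 : ℝ), t ^ (n + 1) * bump t with hA
  have hApos : 0 < A := integral_mul_bump_pos (by fun_prop) fun t ht => by positivity
  have hmom : radialMoment Φ = A • φ := by
    funext y
    have h : ∫ t in Ioi (0 : ℝ), t ^ (n + 1) • Φ (t • (y : EuclideanSpace ℝ (Fin (n + 1)))) =
        ((∫ t in Ioi (0 : ℝ), (t ^ (n + 1) * bump t) * φ y : ℝ) : ℂ) := by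
      rw [← integral_complex_ofReal]
      refine setIntegral_congr_fun measurableSet_Ioi fun t ht => ?_
      simp only [hΦ, annulusSchwartz_apply, annulusExt_smul φ ht, Complex.real_smul]
      push_cast
      ring
    rw [radialMoment, h, Complex.ofReal_re, integral_mul_const]
    rfl
  set c : ℝ := 2 * Real.pi * cosConst * area n * A with hc
  have hcpos : 0 < c := by
    have := cosConst_pos
    have := area_pos n
    have := Real.pi_pos
    positivity
  have hT : T φ = fun x : Sph n => c⁻¹ * (∫ r in Ioi (0 : ℝ), (r ^ 2)⁻¹ •
      (𝓕 Φ 0 - 𝓕 Φ (r • (x : EuclideanSpace ℝ (Fin (n + 1)))))).re := by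
    funext x
    have := T_radialMoment Φ heven x
    rw [hmom, T_smul] at this
    rw [← this, Pi.smul_apply, smul_eq_mul, ← mul_assoc (_ * area n), ← hc,
      inv_mul_cancel_left₀ hcpos.ne']
  rw [hT]
  refine contMDiff_comp_coe (g := fun x => c⁻¹ *
    (∫ r in Ioi (0 : ℝ), (r ^ 2)⁻¹ • (𝓕 Φ 0 - 𝓕 Φ (r • x))).re) ?_
  refine contDiffOn_const.mul (Complex.reCLM.contDiff.comp_contDiffOn ?_)
  exact contDiffOn_integral_second_difference (𝓕 Φ) (fourier_neg_of_even heven)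

/-- `T_radialMoment` is applied to `𝓕 Φ`, with `Φ` the annular extension of `f`. Since `Φ` is even,
`𝓕 (𝓕 Φ) = Φ`, which vanishes at `0` and equals `bump r * f x` at `r • x`; the right side collapses
to `-B * f x`. -/
theorem surjOn_T : SurjOn (T (n := n)) (smoothEven n) (smoothEven n) := by
  intro f hf
  set Φ := annulusSchwartz f hf.1
  have heven : ∀ x, Φ (-x) = Φ x := annulusExt_neg hf.2
  have heven' : ∀ x, 𝓕 Φ (-x) = 𝓕 Φ x := fourier_neg_of_even heven
  have hΦ' : ∀ x, Φ x = annulusExt f x := fun _ => rfl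
  have hinv : ∀ w, 𝓕 (𝓕 Φ) w = Φ w := by
    intro w
    have h1 : 𝓕⁻ (𝓕 Φ) (-w) = 𝓕 (𝓕 Φ) w := by
      rw [SchwartzMap.fourierInv_coe, Real.fourierInv_eq_fourier_neg, neg_neg]
      rfl
    rw [← h1, FourierTransform.fourierInv_fourier_eq, heven]
  set B : ℝ := ∫ r in Ioi (0 : ℝ), (r ^ 2)⁻¹ * bump r with hB
  have hBpos : 0 < B := by
    refine integral_mul_bump_pos ?_ fun t ht => by positivity
    exact ContinuousOn.inv₀ (by fun_prop) fun t ht => by have : 0 < t := ht; positivity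
  set c : ℝ := 2 * Real.pi * cosConst * area n with hc
  have hT : ∀ x : Sph n, c * T (radialMoment (𝓕 Φ)) x = -B * f x := by
    intro x
    rw [hc, T_radialMoment (𝓕 Φ) heven' x]
    have h : ∫ r in Ioi (0 : ℝ), (r ^ 2)⁻¹ • (𝓕 (𝓕 Φ) 0 -
        𝓕 (𝓕 Φ) (r • (x : EuclideanSpace ℝ (Fin (n + 1))))) =
        ((∫ r in Ioi (0 : ℝ), ((r ^ 2)⁻¹ * bump r) * (-f x) : ℝ) : ℂ) := by
      rw [← integral_complex_ofReal]
      refine setIntegral_congr_fun measurableSet_Ioi fun t ht => ?_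
      simp only [hinv, hΦ', annulusExt_smul f ht, annulusExt_zero,
        Complex.real_smul]
      push_cast
      ring
    rw [h, Complex.ofReal_re, integral_mul_const, ← hB]
    ring
  refine ⟨(-(c / B)) • radialMoment (𝓕 Φ),
    smul_mem_smoothEven _ (radialMoment_mem_smoothEven _ heven'), ?_⟩
  rw [T_smul]
  funext x
  rw [Pi.smul_apply, smul_eq_mul, neg_mul, div_mul_eq_mul_div, hT]
  field_simp

/-- If `T` kills `g` and `g = T χ`, then `∫ g² = ∫ g (T χ) = ∫ (T g) χ = 0`. -/
theorem injOn_T : InjOn (T (n := n)) (smoothEven n) := by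
  intro φ hφ ψ hψ h
  have hd : φ + (-1 : ℝ) • ψ ∈ smoothEven n := add_mem_smoothEven hφ (smul_mem_smoothEven _ hψ)
  have hT : T (φ + (-1 : ℝ) • ψ) = 0 := by
    rw [T_add (continuous_of_mem_smoothEven hφ)
      (continuous_of_mem_smoothEven (smul_mem_smoothEven _ hψ)), T_smul, h]
    simp
  obtain ⟨χ, hχ, hχT⟩ := surjOn_T hd
  have h0 := eq_zero_of_integral_sq (continuous_of_mem_smoothEven hd) (by
    nth_rewrite 2 [← hχT]
    rw [integral_mul_T_symm (continuous_of_mem_smoothEven hχ) (continuous_of_mem_smoothEven hd), hT]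
    simp)
  funext x
  have := congrFun h0 x
  simp only [Pi.add_apply, Pi.smul_apply, smul_eq_mul, Pi.zero_apply] at this
  linarith

/-- The cosine transform is a bijection of the space of smooth even functions. -/
theorem bijOn_T : BijOn (T (n := n)) (smoothEven n) (smoothEven n) :=
  ⟨fun _ => T_mem_smoothEven, injOn_T, surjOn_T⟩

end Inversion

/-! ### Pairings and total variation for differences of measures -/

section Measures

variable {n : ℕ}

theorem continuous_absInner_left (x : Sph n) : Continuous fun w : Sph n => absInner w x :=
  continuous_absInner.comp (by fun_prop : Continuous fun w => (w, x))

theorem h_sub_toSignedMeasure (μ ν : Measure (Sph n)) [IsFiniteMeasure μ] [IsFiniteMeasure ν]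
    (x : Sph n) : h (μ.toSignedMeasure - ν.toSignedMeasure) x =
      ∫ w, absInner w x ∂μ - ∫ w, absInner w x ∂ν := by
  have hi : ∀ (μ : Measure (Sph n)) [IsFiniteMeasure μ],
      μ.toSignedMeasure.Integrable fun w => absInner w x := fun μ _ => by
    rw [VectorMeasure.Integrable, Measure.variation_toSignedMeasure]
    exact integrable_of_continuous (continuous_absInner_left x)
  rw [h, VectorMeasure.integral_sub_vectorMeasure (hi μ) (hi ν),
    VectorMeasure.integral_toSignedMeasure, VectorMeasure.integral_toSignedMeasure]

theorem continuous_integral_absInner (μ : Measure (Sph n)) [IsFiniteMeasure μ] :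
    Continuous fun x : Sph n => ∫ w, absInner w x ∂μ := by
  have := continuous_parametric_integral_of_continuous (μ := μ)
    (f := fun x w : Sph n => absInner w x) (continuous_absInner.comp continuous_swap) isCompact_univ
  simpa using this

theorem pairing_h_sub (μ ν : Measure (Sph n)) [IsFiniteMeasure μ] [IsFiniteMeasure ν]
    {ψ : Sph n → ℝ} (hψ : Continuous ψ) :
    pairing ψ (h (μ.toSignedMeasure - ν.toSignedMeasure)) = ∫ w, T ψ w ∂μ - ∫ w, T ψ w ∂ν := by
  unfold pairing
  simp_rw [h_sub_toSignedMeasure, mul_sub]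
  rw [integral_sub, integral_mul_integral_absInner μ hψ, integral_mul_integral_absInner ν hψ]
  · exact integrable_of_continuous (hψ.mul (continuous_integral_absInner μ))
  · exact integrable_of_continuous (hψ.mul (continuous_integral_absInner ν))

/-- Only an inequality, because the two measures need not be mutually singular. -/
theorem totalVariation_sub_le (μ ν : Measure (Sph n)) [IsFiniteMeasure μ] [IsFiniteMeasure ν] :
    ((μ.toSignedMeasure - ν.toSignedMeasure).totalVariation univ).toReal ≤
      μ.real univ + ν.real univ := by
  rw [SignedMeasure.totalVariation_eq_variation, ← measureReal_add_apply]
  refine ENNReal.toReal_mono (measure_ne_top _ _) ?_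
  have := VectorMeasure.variation_sub_le (μ := μ.toSignedMeasure) (ν := ν.toSignedMeasure)
  simp only [Measure.variation_toSignedMeasure] at this
  exact this univ

end Measures

/-! ### The inverse transform and the upper bound by total variation -/

section Inverse

variable {n : ℕ}

theorem Tinv_mem {φ : Sph n → ℝ} (hφ : φ ∈ smoothEven n) : Tinv φ ∈ smoothEven n :=
  Function.invFunOn_mem (surjOn_T hφ)

theorem T_Tinv {φ : Sph n → ℝ} (hφ : φ ∈ smoothEven n) : T (Tinv φ) = φ :=
  Function.invFunOn_eq (surjOn_T hφ)

theorem Tinv_T {φ : Sph n → ℝ} (hφ : φ ∈ smoothEven n) : Tinv (T φ) = φ :=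
  injOn_T (Tinv_mem (T_mem_smoothEven hφ)) hφ (T_Tinv (T_mem_smoothEven hφ))

theorem Tinv_add {φ ψ : Sph n → ℝ} (hφ : φ ∈ smoothEven n) (hψ : ψ ∈ smoothEven n) :
    Tinv (φ + ψ) = Tinv φ + Tinv ψ := by
  have ha := add_mem_smoothEven (Tinv_mem hφ) (Tinv_mem hψ)
  rw [← Tinv_T ha, T_add (continuous_of_mem_smoothEven (Tinv_mem hφ))
    (continuous_of_mem_smoothEven (Tinv_mem hψ)), T_Tinv hφ, T_Tinv hψ]

theorem Tinv_smul (c : ℝ) {φ : Sph n → ℝ} (hφ : φ ∈ smoothEven n) :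
    Tinv (c • φ) = c • Tinv φ := by
  rw [← Tinv_T (smul_mem_smoothEven c (Tinv_mem hφ)), T_smul, T_Tinv hφ]

theorem pairing_Tinv_add {φ ψ f : Sph n → ℝ} (hφ : φ ∈ smoothEven n) (hψ : ψ ∈ smoothEven n)
    (hf : Continuous f) :
    pairing (Tinv (φ + ψ)) f = pairing (Tinv φ) f + pairing (Tinv ψ) f := by
  simp only [pairing, Tinv_add hφ hψ, Pi.add_apply, add_mul]
  exact integral_add
    (integrable_of_continuous ((continuous_of_mem_smoothEven (Tinv_mem hφ)).mul hf))
    (integrable_of_continuous ((continuous_of_mem_smoothEven (Tinv_mem hψ)).mul hf))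

theorem pairing_Tinv_smul (c : ℝ) {φ : Sph n → ℝ} (hφ : φ ∈ smoothEven n) (f : Sph n → ℝ) :
    pairing (Tinv (c • φ)) f = c * pairing (Tinv φ) f := by
  simp only [pairing, Tinv_smul c hφ, Pi.smul_apply, smul_eq_mul, mul_assoc]
  exact integral_const_mul _ _

/-- Fubini moves `T` onto `Tinv φ`, so the pairing is `∫ φ dπ`; the Jordan decomposition then gives
the bound. -/
theorem pairing_Tinv_h_le {φ : Sph n → ℝ} (hφ : φ ∈ smoothEven n) (hb : ∀ x, |φ x| ≤ 1)
    (π : SignedMeasure (Sph n)) :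
    pairing (Tinv φ) (h π) ≤ (π.totalVariation univ).toReal := by
  set μ := π.toJordanDecomposition.posPart with hμ
  set ν := π.toJordanDecomposition.negPart with hν
  have hπ : π = μ.toSignedMeasure - ν.toSignedMeasure :=
    π.toSignedMeasure_toJordanDecomposition.symm
  have hTV : (π.totalVariation univ).toReal = μ.real univ + ν.real univ := by
    rw [← measureReal_add_apply]
    rfl
  have hb' : ∀ (ρ : Measure (Sph n)) [IsFiniteMeasure ρ], |∫ w, φ w ∂ρ| ≤ ρ.real univ :=
    fun ρ _ => by
      have := norm_integral_le_of_norm_le_const (μ := ρ) (f := φ) (C := 1)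
        (Filter.Eventually.of_forall hb)
      simpa using this
  rw [hTV, hπ, pairing_h_sub μ ν (continuous_of_mem_smoothEven (Tinv_mem hφ)), T_Tinv hφ]
  have h1 := abs_le.1 (hb' μ)
  have h2 := abs_le.1 (hb' ν)
  linarith

end Inverse

/-! ### Hahn–Banach and Riesz representation -/

section Representation

variable {X : Type*} [TopologicalSpace X] [CompactSpace X] [T2Space X] [MeasurableSpace X]
  [BorelSpace X]

/-- The Riesz representation theorem for positive functionals on `C(X, ℝ)`, `X` compact. -/
theorem exists_measure_of_positive (L : C(X, ℝ) →ₗ[ℝ] ℝ) (hL : ∀ a, 0 ≤ a → 0 ≤ L a) :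
    ∃ μ : Measure X, IsFiniteMeasure μ ∧ ∀ a : C(X, ℝ), ∫ x, a x ∂μ = L a := by
  let L' : CompactlySupportedContinuousMap X ℝ →ₚ[ℝ] ℝ := PositiveLinearMap.mk₀
    { toFun := fun a => L a.toContinuousMap
      map_add' := fun a b => L.map_add a.toContinuousMap b.toContinuousMap
      map_smul' := fun c a => L.map_smul c a.toContinuousMap }
    (fun a ha => hL a.toContinuousMap ha)
  refine ⟨RealRMK.rieszMeasure L', inferInstance, fun a => ?_⟩
  exact RealRMK.integral_rieszMeasure L' ⟨a, HasCompactSupport.of_compactSpace _⟩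

/-- A bounded linear functional on a subspace of `C(X, ℝ)` is represented by the difference of two
measures whose total mass is at most the bound. -/
theorem exists_measures_of_bounded [Nonempty X] (V : Submodule ℝ C(X, ℝ)) (ℓ : V →ₗ[ℝ] ℝ) {C : ℝ}
    (hC : 0 ≤ C) (hℓ : ∀ v : V, ∀ s : ℝ, (∀ x, |(v : C(X, ℝ)) x| ≤ s) → ℓ v ≤ C * s) :
    ∃ μ ν : Measure X, IsFiniteMeasure μ ∧ IsFiniteMeasure ν ∧
      μ.real univ + ν.real univ ≤ C ∧
      ∀ v : V, ∫ x, (v : C(X, ℝ)) x ∂μ - ∫ x, (v : C(X, ℝ)) x ∂ν = ℓ v := by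
  -- The functional is moved to the antidiagonal pairs `(v, -v)` and dominated there by `C` times
  -- the one-sided supremum `M`. On such pairs `M` is the sup norm of `v`, and domination by `M`
  -- forces the extension to be positive, so its two components are measures with no Jordan
  -- decomposition needed.
  let D : Submodule ℝ (C(X, ℝ) × C(X, ℝ)) :=
    { carrier := {p | p.1 ∈ V ∧ p.2 = -p.1}
      add_mem' := fun {p q} hp hq => ⟨V.add_mem hp.1 hq.1, by
        rw [Prod.snd_add, Prod.fst_add, hp.2, hq.2, neg_add]⟩
      zero_mem' := ⟨V.zero_mem, by simp⟩
      smul_mem' := fun c p hp => ⟨V.smul_mem c hp.1, by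
        rw [Prod.smul_snd, Prod.smul_fst, hp.2, smul_neg]⟩ }
  let pr : D →ₗ[ℝ] V :=
    { toFun := fun p => ⟨p.1.1, p.2.1⟩
      map_add' := fun _ _ => rfl
      map_smul' := fun _ _ => rfl }
  let f : C(X, ℝ) × C(X, ℝ) →ₗ.[ℝ] ℝ := ⟨D, ℓ.comp pr⟩
  let M : C(X, ℝ) × C(X, ℝ) → ℝ := fun p => ⨆ x, max (p.1 x) (p.2 x)
  have hbdd : ∀ p : C(X, ℝ) × C(X, ℝ), BddAbove (range fun x => max (p.1 x) (p.2 x)) := fun p =>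
    (isCompact_range (p.1.continuous.max p.2.continuous)).bddAbove
  have hle : ∀ (p : C(X, ℝ) × C(X, ℝ)) x, max (p.1 x) (p.2 x) ≤ M p := fun p x =>
    le_ciSup (hbdd p) x
  obtain ⟨g, hg, hgM⟩ := exists_extension_of_le_sublinear f (fun p => C * M p)
    (by
      intro c hc p
      have : M (c • p) = c * M p := by
        simp only [M, Prod.smul_fst, Prod.smul_snd, ContinuousMap.smul_apply, smul_eq_mul]
        rw [Real.mul_iSup_of_nonneg hc.le]
        congr 1
        funext x
        exact (mul_max_of_nonneg _ _ hc.le).symm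
      rw [this]
      ring)
    (by
      intro p q
      rw [← mul_add]
      refine mul_le_mul_of_nonneg_left (ciSup_le fun x => ?_) hC
      have h1 := max_le_iff.1 (hle p x)
      have h2 := max_le_iff.1 (hle q x)
      exact max_le (add_le_add h1.1 h2.1) (add_le_add h1.2 h2.2))
    (by
      rintro ⟨p, hp⟩
      refine hℓ ⟨p.1, hp.1⟩ (M p) fun x => ?_
      have h1 := max_le_iff.1 (hle p x)
      rw [hp.2, ContinuousMap.neg_apply] at h1
      exact abs_le'.2 h1)
  have hpos : ∀ p : C(X, ℝ) × C(X, ℝ), (∀ x, 0 ≤ p.1 x ∧ 0 ≤ p.2 x) → 0 ≤ g p := by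
    intro p hp
    have h1 := hgM (-p)
    have h2 : M (-p) ≤ 0 := ciSup_le fun x => max_le (neg_nonpos.2 (hp x).1)
      (neg_nonpos.2 (hp x).2)
    rw [map_neg] at h1
    have := mul_nonpos_of_nonneg_of_nonpos hC h2
    linarith
  obtain ⟨μ, hμ, hμg⟩ := exists_measure_of_positive (g.comp (LinearMap.inl ℝ _ _))
    fun a ha => hpos _ fun x => ⟨ha x, le_rfl⟩
  obtain ⟨ν, hν, hνg⟩ := exists_measure_of_positive (g.comp (LinearMap.inr ℝ _ _))
    fun a ha => hpos _ fun x => ⟨le_rfl, ha x⟩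
  simp only [LinearMap.comp_apply, LinearMap.inl_apply, LinearMap.inr_apply] at hμg hνg
  refine ⟨μ, ν, hμ, hν, ?_, fun v => ?_⟩
  -- The total mass is `g (1, 1)`, and `M (1, 1) ≤ 1`.
  · have h1 := hμg 1
    have h2 := hνg 1
    simp only [ContinuousMap.one_apply, integral_const, smul_eq_mul, mul_one] at h1 h2
    rw [h1, h2, ← map_add]
    refine (hgM _).trans ?_
    have : M ((1, 0) + (0, 1)) ≤ 1 := ciSup_le fun x => by simp
    nlinarith
  · rw [hμg, hνg, ← map_sub]
    have := hg ⟨((v : C(X, ℝ)), -(v : C(X, ℝ))), v.2, rfl⟩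
    have h3 : ((v : C(X, ℝ)), (0 : C(X, ℝ))) - (0, (v : C(X, ℝ))) =
        ((v : C(X, ℝ)), -(v : C(X, ℝ))) := by simp
    rw [h3]
    exact this

end Representation

/-! ### Construction of an even representing measure -/

section Duality

variable {n : ℕ}

/-- The even part `(μ + (-1)^* μ) / 2` of a measure on the sphere. -/
def evenPart (μ : Measure (Sph n)) : Measure (Sph n) :=
  (2⁻¹ : NNReal) • (μ + μ.map fun x => -x)

instance (μ : Measure (Sph n)) [IsFiniteMeasure μ] : IsFiniteMeasure (evenPart μ) := by
  unfold evenPart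
  infer_instance

theorem measurable_neg_sph : Measurable fun x : Sph n => -x := continuous_neg.measurable

theorem evenPart_real_univ (μ : Measure (Sph n)) [IsFiniteMeasure μ] :
    (evenPart μ).real univ = μ.real univ := by
  rw [evenPart, measureReal_nnreal_smul_apply, measureReal_add_apply,
    map_measureReal_apply measurable_neg_sph MeasurableSet.univ, preimage_univ]
  push_cast
  ring

theorem evenPart_real_preimage_neg (μ : Measure (Sph n)) [IsFiniteMeasure μ] {A : Set (Sph n)}
    (hA : MeasurableSet A) :
    (evenPart μ).real ((fun x => -x) ⁻¹' A) = (evenPart μ).real A := by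
  rw [evenPart, measureReal_nnreal_smul_apply, measureReal_nnreal_smul_apply,
    measureReal_add_apply, measureReal_add_apply,
    map_measureReal_apply measurable_neg_sph (measurable_neg_sph hA),
    map_measureReal_apply measurable_neg_sph hA, ← preimage_comp]
  have : ((fun x : Sph n => -x) ∘ fun x => -x) = id := by funext x; simp
  rw [this, preimage_id, add_comm]

theorem integral_evenPart (μ : Measure (Sph n)) [IsFiniteMeasure μ] {φ : Sph n → ℝ}
    (hc : Continuous φ) (he : IsEvenFun φ) : ∫ x, φ x ∂(evenPart μ) = ∫ x, φ x ∂μ := by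
  rw [evenPart, integral_smul_nnreal_measure, integral_add_measure (integrable_of_continuous hc)
    (integrable_of_continuous hc), integral_map measurable_neg_sph.aemeasurable
    hc.aestronglyMeasurable]
  simp only [he _, NNReal.smul_def, smul_eq_mul]
  push_cast
  ring

/-- Against an even function, a test function `χ` may be replaced by `χ x + χ (-x)` at the cost of a
factor `2`, so smooth even test functions already determine `f - g` almost everywhere, hence
everywhere by continuity. -/
theorem eq_of_pairing_eq {f g : Sph n → ℝ} (hf : Continuous f) (hg : Continuous g)
    (hfe : IsEvenFun f) (hge : IsEvenFun g)
    (h : ∀ ψ ∈ smoothEven n, pairing ψ f = pairing ψ g) : f = g := by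
  have hint : ∀ {ψ : Sph n → ℝ}, Continuous ψ → ∀ {u : Sph n → ℝ}, Continuous u →
      Integrable (fun x => ψ x * u x) (unif n) := fun hψ _ hu =>
    integrable_of_continuous (hψ.mul hu)
  have key : ∀ χ : Sph n → ℝ, ContMDiff (𝓡 n) 𝓘(ℝ, ℝ) ∞ χ → HasCompactSupport χ →
      ∫ x, χ x • (f x - g x) ∂(unif n) = 0 := by
    intro χ hχ _
    have hχn : ContMDiff (𝓡 n) 𝓘(ℝ, ℝ) ∞ fun x => χ (-x) := hχ.comp contMDiff_neg_sph
    have h1 := h (fun x => χ x + χ (-x)) ⟨hχ.add hχn, fun x => by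
      simp only [neg_neg, add_comm]⟩
    have hc : Continuous fun x => χ (-x) := hχn.continuous
    have h2 : ∀ u : Sph n → ℝ, Continuous u → IsEvenFun u →
        pairing (fun x => χ x + χ (-x)) u = 2 * ∫ x, χ x * u x ∂(unif n) := by
      intro u hu hue
      have h3 := integral_comp_neg_unif fun x => χ x * u x
      simp only [hue _] at h3
      simp only [pairing, add_mul]
      rw [integral_add (hint hχ.continuous hu) (hint hc hu), h3, two_mul]
    rw [h2 f hf hfe, h2 g hg hge] at h1
    simp only [smul_eq_mul, mul_sub]
    rw [integral_sub (hint hχ.continuous hf) (hint hχ.continuous hg)]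
    linarith
  have hae := ae_eq_zero_of_integral_contMDiff_smul_eq_zero (𝓡 n)
    (integrable_of_continuous (ν := unif n) (hf.sub hg)).locallyIntegrable key
  have := ((hf.sub hg).ae_eq_iff_eq (unif n) continuous_zero).1 hae
  funext x
  exact sub_eq_zero.1 (congrFun this x)

theorem zero_mem_dualValues (f : Sph n → ℝ) : 0 ∈ dualValues f := by
  refine ⟨0, zero_mem_smoothEven, by simp, ?_⟩
  have := pairing_Tinv_smul 0 (zero_mem_smoothEven (n := n)) f
  rw [smul_zero, zero_mul] at this
  exact this.symm

/-- The attained form of the converse bound: the functional `φ ↦ ⟨T⁻¹ φ, f⟩` is represented by `μ -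
ν`, and passing to even parts changes neither its values on even functions nor the masses. -/
theorem exists_evenMeasure_of_dualValues_le {f : Sph n → ℝ} (hf : Continuous f)
    (hfe : IsEvenFun f) {C : ℝ} (hC : C ∈ upperBounds (dualValues f)) :
    ∃ π : SignedMeasure (Sph n), IsEvenMeasure π ∧ f = h π ∧
      (π.totalVariation univ).toReal ≤ C := by
  have hC0 : 0 ≤ C := hC (zero_mem_dualValues f)
  let V : Submodule ℝ C(Sph n, ℝ) :=
    { carrier := {a | ⇑a ∈ smoothEven n}
      add_mem' := fun ha hb => add_mem_smoothEven ha hb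
      zero_mem' := zero_mem_smoothEven
      smul_mem' := fun c _ ha => smul_mem_smoothEven c ha }
  let ℓ : V →ₗ[ℝ] ℝ :=
    { toFun := fun a => pairing (Tinv (a : C(Sph n, ℝ))) f
      map_add' := fun a b => pairing_Tinv_add a.2 b.2 hf
      map_smul' := fun c a => pairing_Tinv_smul c a.2 f }
  have : Nonempty (Sph n) := ⟨radialProj 0⟩
  obtain ⟨μ, ν, hμ, hν, hmass, hrep⟩ := exists_measures_of_bounded V ℓ hC0 (by
    intro v s hs
    have hs0 : 0 ≤ s := (abs_nonneg _).trans (hs (radialProj 0))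
    -- For `s > 0` the rescaled `s⁻¹ • v` is an admissible test function; `s = 0` forces `v = 0`.
    rcases hs0.eq_or_lt with rfl | hpos
    · have hv : v = 0 := by
        ext x
        exact abs_nonpos_iff.1 (hs x)
      simp [hv]
    · have h1 : pairing (Tinv (s⁻¹ • ⇑(v : C(Sph n, ℝ)))) f ≤ C :=
        hC ⟨_, smul_mem_smoothEven _ v.2, fun x => by
          rw [Pi.smul_apply, smul_eq_mul, abs_mul, abs_of_pos (inv_pos.2 hpos),
            inv_mul_le_iff₀ hpos, mul_one]
          exact hs x, rfl⟩
      rw [pairing_Tinv_smul _ v.2, inv_mul_le_iff₀ hpos, mul_comm] at h1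
      exact h1)
  refine ⟨(evenPart μ).toSignedMeasure - (evenPart ν).toSignedMeasure, fun A hA => ?_, ?_, ?_⟩
  · rw [sub_apply, sub_apply,
      Measure.toSignedMeasure_apply_measurable hA, Measure.toSignedMeasure_apply_measurable hA,
      Measure.toSignedMeasure_apply_measurable (measurable_neg_sph hA),
      Measure.toSignedMeasure_apply_measurable (measurable_neg_sph hA),
      evenPart_real_preimage_neg μ hA, evenPart_real_preimage_neg ν hA]
  · refine eq_of_pairing_eq hf ?_ hfe ?_ fun ψ hψ => ?_
    · have : h ((evenPart μ).toSignedMeasure - (evenPart ν).toSignedMeasure) = fun x =>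
          ∫ w, absInner w x ∂(evenPart μ) - ∫ w, absInner w x ∂(evenPart ν) :=
        funext (h_sub_toSignedMeasure _ _)
      rw [this]
      exact (continuous_integral_absInner _).sub (continuous_integral_absInner _)
    · intro x
      simp only [h_sub_toSignedMeasure, absInner_neg_right]
    · have hT := T_mem_smoothEven hψ
      have hTc := continuous_of_mem_smoothEven hT
      rw [pairing_h_sub _ _ (continuous_of_mem_smoothEven hψ), integral_evenPart μ hTc hT.2,
        integral_evenPart ν hTc hT.2]
      -- The representation is tested on `T ψ`, where the functional equals `⟨ψ, f⟩`.
      have := hrep ⟨⟨T ψ, hTc⟩, hT⟩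
      simp only [ContinuousMap.coe_mk] at this
      rw [this]
      change _ = pairing (Tinv (T ψ)) f
      rw [Tinv_T hψ]
  · refine (totalVariation_sub_le _ _).trans ?_
    rwa [evenPart_real_univ, evenPart_real_univ]

theorem totalVariation_mem_upperBounds (π : SignedMeasure (Sph n)) :
    (π.totalVariation univ).toReal ∈ upperBounds (dualValues (h π)) := by
  rintro r ⟨φ, hφ, hb, rfl⟩
  exact pairing_Tinv_h_le hφ hb π

end Duality

end CosineTransform

end

theorem mainTheorem6 (n : ℕ) (hn : 1 ≤ n) :
    Set.BijOn (CosineTransform.T (n := n))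
      (CosineTransform.smoothEven n) (CosineTransform.smoothEven n) ∧
    ∀ f : CosineTransform.Sph n → ℝ, Continuous f → CosineTransform.IsEvenFun f →
      (f ∈ CosineTransform.H1 n ↔ BddAbove (CosineTransform.dualValues f)) ∧
      (f ∈ CosineTransform.H1 n →
        IsLUB (CosineTransform.dualValues f) (CosineTransform.gamma1 f)) := by
  refine ⟨CosineTransform.bijOn_T, fun f hf hfe => ⟨⟨?_, ?_⟩, ?_⟩⟩
  · rintro ⟨π, -, rfl⟩
    exact ⟨_, CosineTransform.totalVariation_mem_upperBounds π⟩
  · rintro ⟨C, hC⟩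
    obtain ⟨π, hπ, hfπ, -⟩ := CosineTransform.exists_evenMeasure_of_dualValues_le hf hfe hC
    exact ⟨π, hπ, hfπ⟩
  · rintro ⟨π₀, hπ₀, hfπ₀⟩
    constructor
    · intro r hr
      refine le_csInf ⟨_, π₀, hπ₀, hfπ₀, rfl⟩ ?_
      rintro _ ⟨π, -, hfπ, rfl⟩
      exact CosineTransform.totalVariation_mem_upperBounds π (hfπ ▸ hr)
    · intro C hC
      -- Every upper bound `C` dominates the mass of some competitor in the infimum, whence `γ₁(f) ≤
      -- C`.
      obtain ⟨π, hπ, hfπ, hle⟩ := CosineTransform.exists_evenMeasure_of_dualValues_le hf hfe hC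
      refine le_trans (csInf_le ⟨0, ?_⟩ ⟨π, hπ, hfπ, rfl⟩) hle
      rintro _ ⟨_, _, _, rfl⟩
      exact ENNReal.toReal_nonneg
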